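/- Let $t \in \mathbb{R}$. Let $M(t)$ be the $12$-dimensional real commutative (non-associative) algebra with basis $a_1, a_{-1}, a_2, a_{-2}, a_3, a_{-3}, v_1, v_2, v_3, w_1, w_2, w_3$ (here $v_k = v_{(i,j)}$ and $w_k = a_k \cdot v_{(i,j)}$ for $\{i,j,k\} = \{1,2,3\}$) whose product is the bilinear one given as follows, for all $\{i,j,k\} = \{1,2,3\}$ and all signs $\varepsilon, \delta \in \{1,-1\}$: $$a_{\varepsilon i} \cdot a_{\varepsilon i} = a_{\varepsilon i}, \qquad a_i \cdot a_{-i} = 0, \qquad a_{\varepsilon i} \cdot a_{\delta j} = \tfrac{1}{64}\left(3a_{\varepsilon i} + 3a_{\delta j} + a_{-\varepsilon i} + a_{-\delta j} - 3v_k\right),$$ $$a_i \cdot v_i = w_i, \qquad a_{-i} \cdot v_i = w_i - t(a_i - a_{-i}), \qquad a_{\varepsilon i} \cdot v_k = \tfrac{1}{16}\left(5a_{\varepsilon i} - 2a_j - 2a_{-j} - a_{-\varepsilon i} + 3v_k\right),$$ $$a_i \cdot w_i = \tfrac{3t}{4}a_i + \tfrac14 w_i, \qquad a_{-i} \cdot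 w_i = -\tfrac{t}{4}a_i + \tfrac14 w_i,$$ $$a_j \cdot w_i = \tfrac{t}{8}a_j - \tfrac{3t}{64}(a_i - a_{-i}) + \tfrac{t}{16}(a_k - a_{-k}) + \tfrac{1}{16}(2w_i + w_j - 2w_k),$$ $$a_{-j} \cdot w_i = \tfrac{t}{16}(3a_{-j} - a_j) - \tfrac{3t}{64}(a_i - a_{-i}) + \tfrac{t}{16}(a_k - a_{-k}) + \tfrac{1}{16}(2w_i + w_j - 2w_k),$$ $$v_i \cdot v_i = v_i, \qquad v_j \cdot v_k = -\tfrac{8t}{3}a_i + \tfrac{2t}{3}(a_j - a_{-j} + a_k - a_{-k}) + \tfrac14(v_j + v_k - v_i) + \tfrac43(2w_i - w_j - w_k),$$ $$v_i \cdot w_i = \tfrac{(2t-1)t}{4}(a_i - a_{-i}) + \tfrac{t}{4}v_i + \tfrac12 w_i,$$ $$v_k \cdot w_i = -\tfrac{5t}{48}a_i - \tfrac{11t}{48}a_{-i} - \tfrac{11t}{24}a_j - \tfrac{5t}{24}a_{-j} + \tfrac{t}{8}v_k + \tfrac14(w_i + w_j),$$ $$w_i \cdot w_i = \tfrac{(10t+1)t}{16}a_i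 - \tfrac{(2t-1)t}{16}a_{-i} + \tfrac{t}{16}v_i + \tfrac{t}{4}w_i,$$ $$w_i \cdot w_j = \tfrac{t^2}{32}(a_i - a_{-i} + a_j - a_{-j}) + \tfrac{(2t-1)t}{32}a_k - \tfrac{(2t+1)t}{32}a_{-k} + \tfrac{t}{64}(2v_k + v_i + v_j) + \tfrac{t}{8}(w_i + w_j - w_k).$$ Let $\langle\,,\,\rangle$ be the Frobenius form on $M(t)$, that is, the symmetric bilinear form given, for all $i \neq j$ in $\{1,2,3\}$ and all signs $\varepsilon, \delta$, by $$\langle a_{\varepsilon i}, a_{\varepsilon i}\rangle = 1, \quad \langle a_i, a_{-i}\rangle = 0, \quad \langle a_{\varepsilon i}, a_{\delta j}\rangle = \tfrac{1}{32}, \quad \langle a_{\varepsilon i}, v_i\rangle = t, \quad \langle a_{\varepsilon i}, v_j\rangle = \tfrac38,$$ $$\langle a_i, w_i\rangle = t, \quad \langle a_{-i}, w_i\rangle = 0, \quad \langle a_{\varepsilon j}, w_i\rangle = \tfrac{3t}{16}, \quad \langle v_i, v_i\rangle = 2, \quad \langle v_i, v_j\rangle = \tfrac12 - \tfrac{8t}{3},$$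 $$\langle v_i, w_i\rangle = t, \quad \langle v_j, w_i\rangle = -\tfrac{t}{4}, \quad \langle w_i, w_i\rangle = \tfrac{(3t+1)t}{4}, \quad \langle w_i, w_j\rangle = \tfrac{(2t+1)t}{16}.$$ Then $M(t)$ satisfies Norton's inequality $$\langle u \cdot u, v \cdot v \rangle \geq \langle u \cdot v, u \cdot v \rangle \quad \text{for all } u, v \in M(t)$$ if and only if $t \in [0, \tfrac16]$. -/

import Mathlib

namespace FourA

/-- Labels of the twelve basis vectors of the algebra `M(t)`. The indices `1, 2, 3` of the six axes
are represented by `Fin 3` (in this cyclic order `0, 1, 2`), and a sign by a `Bool` (`true` is `+`).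
* `a i true` is the axis `a_i` and `a i false` is the axis `a_{-i}`;
* `v k` is the vector `v_{(i,j)}`, where `{i, j, k} = {1, 2, 3}`;
* `w k` is the vector `a_k · v_{(i,j)}`, where `{i, j, k} = {1, 2, 3}`. -/
inductive Idx : Type
  | a (i : Fin 3) (s : Bool)
  | v (k : Fin 3)
  | w (k : Fin 3)
  deriving DecidableEq, Fintype

/-- The underlying real vector space of the 12-dimensional algebra `M(t)`: coordinate vectors with
respect to the basis. The six axes generate the algebra, and `t` is the value `⟨a_1, v_{(2,3)}⟩` of
the Frobenius form. -/
def M (_t : ℝ) : Type := Idx → ℝ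

noncomputable instance (t : ℝ) : AddCommGroup (M t) := inferInstanceAs (AddCommGroup (Idx → ℝ))

noncomputable instance (t : ℝ) : Module ℝ (M t) := inferInstanceAs (Module ℝ (Idx → ℝ))

/-- The basis vector with a given label. -/
noncomputable def e (t : ℝ) (p : Idx) : M t := (Pi.single p 1 : Idx → ℝ)

/-- The axis `a_i` (for `s = true`) or `a_{-i}` (for `s = false`). -/
noncomputable def ax (t : ℝ) (i : Fin 3) (s : Bool) : M t := e t (Idx.a i s)

/-- The vector `v_{(i,j)}`, labelled by the third index `k`. -/
noncomputable def vv (t : ℝ) (k : Fin 3) : M t := e t (Idx.v k)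

/-- The vector `a_k · v_{(i,j)}`, where `{i, j, k} = {1, 2, 3}`. -/
noncomputable def ww (t : ℝ) (k : Fin 3) : M t := e t (Idx.w k)

/-- For `i ≠ j`, the index different from `i` and `j`: the three indices sum to zero modulo `3`. -/
def third (i j : Fin 3) : Fin 3 := -(i + j)

/-- The products `a_{±i} · a_{±j}`: the axes are idempotents, `⟨⟨a_i, a_{-i}⟩⟩` is a dihedral
algebra of type `2B`, and `⟨⟨a_{±i}, a_{±j}⟩⟩` is a dihedral algebra of type `4A` for `i ≠ j`. -/
noncomputable def mulAA (t : ℝ) (i : Fin 3) (s : Bool) (j : Fin 3) (r : Bool) : M t :=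
  if i = j then (if s = r then ax t i s else 0)
  else (1 / 64 : ℝ) • ((3 : ℝ) • ax t i s + (3 : ℝ) • ax t j r + ax t i (!s) + ax t j (!r)
    - (3 : ℝ) • vv t (third i j))

/-- The products of `a_{±i}` with the vector `v` labelled by `k`. If `i = k`, then
`a_i · v = w` is a basis vector and `a_{-i} · v = w - t (a_i - a_{-i})`; if `i ≠ k`, then the product
lies in the dihedral algebra of type `4A` generated by `a_i` and `a_j`, where `j` is the third
index. -/
noncomputable def mulAV (t : ℝ) (i : Fin 3) (s : Bool) (k : Fin 3) : M t :=
  if i = k then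
    (if s = true then ww t k else ww t k - t • (ax t k true - ax t k false))
  else (1 / 16 : ℝ) • ((5 : ℝ) • ax t i s
    - (2 : ℝ) • (ax t (third i k) true + ax t (third i k) false) - ax t i (!s)
    + (3 : ℝ) • vv t k)

/-- The products of `a_{±j}` with the vector `w` labelled by `i`. -/
noncomputable def mulAW (t : ℝ) (j : Fin 3) (s : Bool) (i : Fin 3) : M t :=
  if j = i then
    (if s = true then (3 * t / 4) • ax t i true + (1 / 4 : ℝ) • ww t i
      else (-t / 4) • ax t i true + (1 / 4 : ℝ) • ww t i)
  else
    (if s = true then (2 * t / 16) • ax t j true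
      else (t / 16) • ((3 : ℝ) • ax t j false - ax t j true))
    - (3 * t / 64) • (ax t i true - ax t i false)
    + (t / 16) • (ax t (third i j) true - ax t (third i j) false)
    + (1 / 16 : ℝ) • ((2 : ℝ) • ww t i + ww t j - (2 : ℝ) • ww t (third i j))

/-- The products `v_{(i,k)} · v_{(i,j)}`, labelled by `j` and `k`. -/
noncomputable def mulVV (t : ℝ) (j k : Fin 3) : M t :=
  if j = k then vv t j
  else
    (-(8 * t / 3)) • ax t (third j k) true
    + (2 * t / 3) • (ax t j true - ax t j false + ax t k true - ax t k false)
    + (1 / 4 : ℝ) • (vv t j + vv t k - vv t (third j k))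
    + (4 / 3 : ℝ) • ((2 : ℝ) • ww t (third j k) - ww t j - ww t k)

/-- The products of the vector `v` labelled by `k` with the vector `w` labelled by `i`. -/
noncomputable def mulVW (t : ℝ) (k i : Fin 3) : M t :=
  if k = i then
    ((2 * t - 1) * t / 4) • (ax t i true - ax t i false) + (t / 4) • vv t i
    + (1 / 2 : ℝ) • ww t i
  else
    (-(5 * t / 48)) • ax t i true - (11 * t / 48) • ax t i false
    - (11 * t / 24) • ax t (third i k) true - (5 * t / 24) • ax t (third i k) false
    + (t / 8) • vv t k + (1 / 4 : ℝ) • (ww t i + ww t (third i k))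

/-- The products of the vectors `w` labelled by `i` and `j`. -/
noncomputable def mulWW (t : ℝ) (i j : Fin 3) : M t :=
  if i = j then
    ((10 * t + 1) * t / 16) • ax t i true - ((2 * t - 1) * t / 16) • ax t i false
    + (t / 16) • vv t i + (t / 4) • ww t i
  else
    (t ^ 2 / 32) • (ax t i true - ax t i false + ax t j true - ax t j false)
    + ((2 * t - 1) * t / 32) • ax t (third i j) true
    - ((2 * t + 1) * t / 32) • ax t (third i j) false
    + (t / 64) • ((2 : ℝ) • vv t (third i j) + vv t i + vv t j)
    + (t / 8) • (ww t i + ww t j - ww t (third i j))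

/-- The algebra product of two basis vectors. -/
noncomputable def mulBasis (t : ℝ) : Idx → Idx → M t
  | .a i s, .a j r => mulAA t i s j r
  | .a i s, .v k => mulAV t i s k
  | .v k, .a i s => mulAV t i s k
  | .a j s, .w i => mulAW t j s i
  | .w i, .a j s => mulAW t j s i
  | .v j, .v k => mulVV t j k
  | .v k, .w i => mulVW t k i
  | .w i, .v k => mulVW t k i
  | .w i, .w j => mulWW t i j

theorem mulAA_comm (t : ℝ) (i : Fin 3) (s : Bool) (j : Fin 3) (r : Bool) :
    mulAA t i s j r = mulAA t j r i s := by
  unfold mulAA third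
  rw [add_comm i j]
  by_cases h : i = j
  · subst h
    by_cases h' : s = r
    · subst h'; rfl
    · simp [h', Ne.symm h']
  · simp only [h, Ne.symm h, if_false]
    module

theorem mulVV_comm (t : ℝ) (j k : Fin 3) : mulVV t j k = mulVV t k j := by
  unfold mulVV third
  rw [add_comm j k]
  by_cases h : j = k
  · subst h; rfl
  · simp only [h, Ne.symm h, if_false]
    module

theorem mulWW_comm (t : ℝ) (i j : Fin 3) : mulWW t i j = mulWW t j i := by
  unfold mulWW third
  rw [add_comm i j]
  by_cases h : i = j
  · subst h; rfl
  · simp only [h, Ne.symm h, if_false]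
    module

theorem mulBasis_comm (t : ℝ) (p q : Idx) : mulBasis t p q = mulBasis t q p := by
  cases p <;> cases q <;> simp only [mulBasis]
  · exact mulAA_comm _ _ _ _ _
  · exact mulVV_comm _ _ _
  · exact mulWW_comm _ _ _

/-- The algebra product on `M(t)`: the bilinear extension of the product of basis vectors. -/
noncomputable def mulM (t : ℝ) (x y : M t) : M t :=
  ∑ p : Idx, ∑ q : Idx, (x p * y q) • mulBasis t p q

theorem M_add_apply (t : ℝ) (x y : M t) (p : Idx) : (x + y) p = x p + y p := rfl

theorem M_smul_apply (t c : ℝ) (x : M t) (p : Idx) : (c • x) p = c * x p := rfl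

theorem M_zero_apply (t : ℝ) (p : Idx) : (0 : M t) p = 0 := rfl

theorem mulM_comm (t : ℝ) (x y : M t) : mulM t x y = mulM t y x := by
  unfold mulM
  rw [Finset.sum_comm]
  refine Finset.sum_congr rfl fun p _ => Finset.sum_congr rfl fun q _ => ?_
  rw [mulBasis_comm, mul_comm]

theorem mulM_add (t : ℝ) (x y z : M t) : mulM t x (y + z) = mulM t x y + mulM t x z := by
  simp only [mulM, M_add_apply, mul_add, add_smul, Finset.sum_add_distrib]

theorem mulM_zero (t : ℝ) (x : M t) : mulM t x 0 = 0 := by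
  simp [mulM, M_zero_apply]

/-- `M(t)` is a commutative, not necessarily associative, ring. -/
noncomputable instance (t : ℝ) : NonUnitalNonAssocCommRing (M t) where
  __ := (inferInstance : AddCommGroup (M t))
  mul := mulM t
  left_distrib := mulM_add t
  right_distrib x y z := by
    change mulM t (x + y) z = mulM t x z + mulM t y z
    rw [mulM_comm, mulM_add, mulM_comm t z x, mulM_comm t z y]
  zero_mul x := by
    change mulM t 0 x = 0
    rw [mulM_comm, mulM_zero]
  mul_zero := mulM_zero t
  mul_comm := mulM_comm t

theorem M_mul_def (t : ℝ) (x y : M t) :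
    x * y = ∑ p : Idx, ∑ q : Idx, (x p * y q) • mulBasis t p q := rfl

theorem e_mul_e (t : ℝ) (p q : Idx) : e t p * e t q = mulBasis t p q := by
  rw [M_mul_def]
  simp [e, Pi.single_apply]

instance (t : ℝ) : IsScalarTower ℝ (M t) (M t) where
  smul_assoc c x y := by
    change (c • x) * y = c • (x * y)
    simp only [M_mul_def, M_smul_apply, Finset.smul_sum, smul_smul, mul_assoc]

instance (t : ℝ) : SMulCommClass ℝ (M t) (M t) where
  smul_comm c x y := by
    change c • (x * y) = x * (c • y)
    rw [mul_comm x y, mul_comm x (c • y)]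
    exact (smul_assoc c y x).symm

/-- The value of the Frobenius form on two basis vectors. -/
noncomputable def gram (t : ℝ) : Idx → Idx → ℝ
  | .a i s, .a j r => if i = j then (if s = r then 1 else 0) else 1 / 32
  | .a i _, .v k => if i = k then t else 3 / 8
  | .v k, .a i _ => if i = k then t else 3 / 8
  | .a j s, .w i => if j = i then (if s = true then t else 0) else 3 * t / 16
  | .w i, .a j s => if j = i then (if s = true then t else 0) else 3 * t / 16
  | .v j, .v k => if j = k then 2 else -(8 * t / 3) + 1 / 2
  | .v k, .w i => if k = i then t else -(t / 4)
  | .w i, .v k => if k = i then t else -(t / 4)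
  | .w i, .w j => if i = j then (3 * t + 1) * t / 4 else (2 * t + 1) * t / 16

/-- The Frobenius form on `M(t)`: the bilinear extension of its values on basis vectors. -/
noncomputable def form (t : ℝ) : LinearMap.BilinForm ℝ (M t) :=
  LinearMap.mk₂ ℝ (fun x y => ∑ p : Idx, ∑ q : Idx, x p * y q * gram t p q)
    (fun x y z => by simp only [M_add_apply, add_mul, Finset.sum_add_distrib])
    (fun c x y => by simp only [M_smul_apply, mul_assoc, Finset.mul_sum, smul_eq_mul])
    (fun x y z => by simp only [M_add_apply, mul_add, add_mul, Finset.sum_add_distrib])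
    (fun c x y => by
      simp only [M_smul_apply, Finset.mul_sum, smul_eq_mul]
      exact Finset.sum_congr rfl fun p _ => Finset.sum_congr rfl fun q _ => by ring)

theorem e_apply (t : ℝ) (p q : Idx) : e t p q = if q = p then 1 else 0 := by
  simp [e, Pi.single_apply]

theorem form_e_e (t : ℝ) (p q : Idx) : form t (e t p) (e t q) = gram t p q := by
  simp [form, e_apply]

/-- Norton's inequality for a real commutative algebra with a bilinear form:
`⟨u · u, v · v⟩ ≥ ⟨u · v, u · v⟩` for all `u` and `v`. -/
def NortonInequality {V : Type*} [NonUnitalNonAssocCommRing V] [Module ℝ V]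
    (B : LinearMap.BilinForm ℝ V) : Prop :=
  ∀ u v : V, B (u * u) (v * v) ≥ B (u * v) (u * v)

end FourA

/-!
For `t ∈ [0, 1/6]` write `t = (1 - Re ζ) / 12` with `|ζ| = 1`, and let `ξ₁, ξ₂, ξ₃ ∈ ℂ³` be unit
vectors whose inner products have absolute value `1/4` and whose triple product has phase `ζ`. The
part of `M(t)` fixed by `a_i ↔ a_{-i}` is then a Jordan algebra of Hermitian operators, in which
`a_i + a_{-i}` is the projection `|ξ_i⟩⟨ξ_i|` and the form is the trace form. The differences
`d_i = a_i - a_{-i}` satisfy `d_i d_i = |ξ_i⟩⟨ξ_i|`, `d_i d_j = 0` and `A d_i = ⟨ξ_i, A ξ_i⟩ d_i`.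
The terms of Norton's inequality without a `d_i` amount to the positivity of the square of a
commutator, those with two of them to the inequality `⟨A⟩² ≤ ⟨A²⟩`, and those with four of them to
the Cauchy–Schwarz inequality.

Conversely, the pair `v_1`, `d_1` gives `0 ≤ t ≤ 1`, and a pair `u`, `d_1` with `u d_1 = 0`
gives `t ≤ 1/6`.
-/

namespace FourA

open Matrix RCLike
open scoped ComplexOrder MatrixOrder

/-! ### Jordan algebras of matrices with odd units -/

section AxialExtension

variable {n 𝕜 : Type*} [RCLike 𝕜]

/-- The diagonal matrix with the given real entries, as a real-linear map. -/
noncomputable def realDiagonal [DecidableEq n] : (n → ℝ) →ₗ[ℝ] Matrix n n 𝕜 :=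
  diagonalLinearMap n ℝ 𝕜 ∘ₗ (ofRealAm (K := 𝕜)).toLinearMap.compLeft n

theorem realDiagonal_apply [DecidableEq n] (c : n → ℝ) :
    (realDiagonal c : Matrix n n 𝕜) = diagonal fun i => (c i : 𝕜) := rfl

theorem realDiagonal_single [DecidableEq n] (i : n) :
    (realDiagonal (Pi.single i 1) : Matrix n n 𝕜) = single i i 1 := by
  rw [realDiagonal_apply, ← diagonal_single]
  congr 1
  ext j
  by_cases h : j = i <;> simp [h]

variable [Fintype n]

/-- A matrix `X` is read as the operator `∑ X i j |ξ i⟩⟨ξ j|`, where `ξ` is a family of vectors with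
Gram matrix `G`. This is the Jordan product `(A B + B A) / 2` of operators in terms of such
coefficient matrices. -/
noncomputable def gramProd (G : Matrix n n 𝕜) :
    Matrix n n 𝕜 →ₗ[ℝ] Matrix n n 𝕜 →ₗ[ℝ] Matrix n n 𝕜 :=
  LinearMap.mk₂ ℝ (fun X Y => (2⁻¹ : ℝ) • (X * G * Y + Y * G * X))
    (fun X X' Y => by simp only [add_mul, mul_add]; module)
    (fun c X Y => by simp only [smul_mul_assoc, mul_smul_comm]; module)
    (fun X Y Y' => by simp only [add_mul, mul_add]; module)
    (fun c X Y => by simp only [smul_mul_assoc, mul_smul_comm]; module)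

/-- The real part of the trace of the operator `∑ X i j |ξ i⟩⟨ξ j|`. -/
noncomputable def gramTrace (G : Matrix n n 𝕜) : Matrix n n 𝕜 →ₗ[ℝ] ℝ where
  toFun X := re (trace (G * X))
  map_add' X Y := by rw [mul_add, trace_add, map_add]
  map_smul' c X := by rw [mul_smul_comm, trace_smul, smul_re, RingHom.id_apply, smul_eq_mul]

/-- The trace form `re (tr (A B))` of operators, in terms of their coefficient matrices. -/
noncomputable def gramForm (G : Matrix n n 𝕜) : LinearMap.BilinForm ℝ (Matrix n n 𝕜) :=
  LinearMap.mk₂ ℝ (fun X Y => re (trace (G * X * (G * Y))))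
    (fun X X' Y => by simp only [add_mul, mul_add, trace_add, map_add])
    (fun c X Y => by simp only [smul_mul_assoc, mul_smul_comm, trace_smul, smul_re, smul_eq_mul])
    (fun X Y Y' => by simp only [mul_add, trace_add, map_add])
    (fun c X Y => by simp only [mul_smul_comm, trace_smul, smul_re, smul_eq_mul])

/-- The expectations `re ⟨ξ i, A (ξ i)⟩` of an operator `A`, in terms of its coefficient matrix. -/
noncomputable def expectation (G : Matrix n n 𝕜) : Matrix n n 𝕜 →ₗ[ℝ] n → ℝ where
  toFun X i := re ((G * X * G) i i)
  map_add' X Y := by ext i; simp only [mul_add, add_mul, Matrix.add_apply, map_add, Pi.add_apply]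
  map_smul' c X := by
    ext i
    simp only [mul_smul_comm, smul_mul_assoc, Matrix.smul_apply, smul_re, RingHom.id_apply,
      Pi.smul_apply, smul_eq_mul]

variable (G : Matrix n n 𝕜)

theorem gramProd_apply (X Y : Matrix n n 𝕜) :
    gramProd G X Y = (2⁻¹ : ℝ) • (X * G * Y + Y * G * X) := rfl

theorem gramTrace_apply (X : Matrix n n 𝕜) : gramTrace G X = re (trace (G * X)) := rfl

theorem gramForm_apply (X Y : Matrix n n 𝕜) : gramForm G X Y = re (trace (G * X * (G * Y))) := rfl

theorem expectation_apply (X : Matrix n n 𝕜) (i : n) :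
    expectation G X i = re ((G * X * G) i i) := rfl

theorem gramProd_comm (X Y : Matrix n n 𝕜) : gramProd G X Y = gramProd G Y X := by
  rw [gramProd_apply, gramProd_apply, add_comm]

theorem gramProd_self (X : Matrix n n 𝕜) : gramProd G X X = X * G * X := by
  rw [gramProd_apply, ← two_smul ℝ, smul_smul, inv_mul_cancel₀ two_ne_zero, one_smul]

theorem gramForm_comm (X Y : Matrix n n 𝕜) : gramForm G X Y = gramForm G Y X := by
  rw [gramForm_apply, gramForm_apply, trace_mul_comm]

theorem gramForm_eq_gramTrace (X Y : Matrix n n 𝕜) :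
    gramForm G X Y = gramTrace G (gramProd G X Y) := by
  have hcyclic : trace (G * Y * (G * X)) = trace (G * X * (G * Y)) := trace_mul_comm _ _
  simp only [Matrix.mul_assoc] at hcyclic
  simp only [gramForm_apply, gramTrace_apply, gramProd_apply, mul_smul_comm, mul_add, trace_smul,
    trace_add, smul_re, map_add, Matrix.mul_assoc, hcyclic]
  ring

theorem gramForm_realDiagonal [DecidableEq n] (X : Matrix n n 𝕜) (c : n → ℝ) :
    gramForm G X (realDiagonal c) = expectation G X ⬝ᵥ c := by
  rw [gramForm_apply, ← Matrix.mul_assoc, trace, dotProduct, map_sum]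
  refine Finset.sum_congr rfl fun i _ => ?_
  rw [diag_apply, realDiagonal_apply, mul_diagonal, expectation_apply, mul_comm, re_ofReal_mul,
    mul_comm]

theorem expectation_eq_gramTrace [DecidableEq n] (X : Matrix n n 𝕜) (i : n) :
    expectation G X i = gramTrace G (gramProd G (single i i 1) X) := by
  rw [← realDiagonal_single, ← gramForm_eq_gramTrace, gramForm_comm, gramForm_realDiagonal,
    dotProduct_single_one]

variable {G}

theorem expectation_realDiagonal [DecidableEq n] (hG : G.IsHermitian) (c : n → ℝ) (i : n) :
    expectation G (realDiagonal c) i = ∑ j, normSq (G i j) * c j := by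
  rw [expectation_apply, Matrix.mul_apply, map_sum]
  refine Finset.sum_congr rfl fun j _ => ?_
  rw [realDiagonal_apply, mul_diagonal, ← hG.apply j i, mul_right_comm, star_def, mul_conj,
    ← ofReal_pow, ← ofReal_mul, ofReal_re, normSq_eq_def']

theorem trace_jordan_sub (A B : Matrix n n 𝕜) :
    trace (A * A * (B * B)) -
        trace ((2⁻¹ : ℝ) • (A * B + B * A) * ((2⁻¹ : ℝ) • (A * B + B * A))) =
      -(4⁻¹ : ℝ) • trace ((A * B - B * A) * (A * B - B * A)) := by
  have hABBA : trace (A * B * (B * A)) = trace (A * A * (B * B)) := by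
    rw [← Matrix.mul_assoc, trace_mul_comm]; simp only [Matrix.mul_assoc]
  have hBAAB : trace (B * A * (A * B)) = trace (A * A * (B * B)) := by
    rw [Matrix.mul_assoc, trace_mul_comm]; simp only [Matrix.mul_assoc]
  have hBABA : trace (B * A * (B * A)) = trace (A * B * (A * B)) := by
    rw [Matrix.mul_assoc, trace_mul_comm]; simp only [Matrix.mul_assoc]
  simp only [mul_add, add_mul, mul_sub, sub_mul, smul_mul_assoc, mul_smul_comm, smul_add, trace_add,
    trace_sub, trace_smul, hABBA, hBAAB, hBABA]
  module

open scoped Matrix.Norms.L2Operator in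
theorem re_trace_mul_mul_mul_nonneg (hG : G.PosSemidef) (C : Matrix n n 𝕜) :
    0 ≤ re (trace (Cᴴ * G * C * G)) := by
  classical
  obtain ⟨B, rfl⟩ := CStarAlgebra.nonneg_iff_eq_star_mul_self.mp hG.nonneg
  have h : trace (Cᴴ * (star B * B) * C * (star B * B)) = trace ((B * C * Bᴴ)ᴴ * (B * C * Bᴴ)) := by
    rw [← Matrix.mul_assoc, trace_mul_comm]
    simp only [star_eq_conjTranspose, conjTranspose_mul, conjTranspose_conjTranspose,
      Matrix.mul_assoc]
  rw [h]
  exact (RCLike.nonneg_iff.1 (posSemidef_conjTranspose_mul_self _).trace_nonneg).1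

theorem gramForm_gramProd_le {X Y : Matrix n n 𝕜} (hG : G.PosSemidef) (hX : X.IsHermitian)
    (hY : Y.IsHermitian) :
    gramForm G (gramProd G X Y) (gramProd G X Y) ≤
      gramForm G (gramProd G X X) (gramProd G Y Y) := by
  set C := X * G * Y - Y * G * X with hC
  have hskew : Cᴴ = -C := by
    simp only [hC, conjTranspose_sub, conjTranspose_mul, hX.eq, hY.eq, hG.1.eq, Matrix.mul_assoc,
      neg_sub]
  have hprod : G * gramProd G X Y = (2⁻¹ : ℝ) • (G * X * (G * Y) + G * Y * (G * X)) := by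
    simp only [gramProd_apply, mul_smul_comm, mul_add, Matrix.mul_assoc]
  have hcomm : trace ((G * X * (G * Y) - G * Y * (G * X)) * (G * X * (G * Y) - G * Y * (G * X))) =
      -trace (Cᴴ * G * C * G) := by
    have : G * X * (G * Y) - G * Y * (G * X) = G * C := by
      simp only [hC, mul_sub, Matrix.mul_assoc]
    rw [this, hskew, Matrix.mul_assoc, trace_mul_comm]
    simp only [neg_mul, trace_neg, neg_neg, Matrix.mul_assoc]
  have hsq (Z : Matrix n n 𝕜) : G * gramProd G Z Z = G * Z * (G * Z) := by
    simp only [gramProd_self, Matrix.mul_assoc]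
  have key := trace_jordan_sub (G * X) (G * Y)
  rw [hcomm, smul_neg, neg_smul, neg_neg] at key
  rw [gramForm_apply, gramForm_apply, hsq, hsq, hprod, ← sub_nonneg, ← map_sub, key, smul_re]
  exact mul_nonneg (by norm_num) (re_trace_mul_mul_mul_nonneg hG C)

theorem sq_expectation_le {X : Matrix n n 𝕜} (hG : G.PosSemidef) (hX : X.IsHermitian) {i : n}
    (hi : G i i = 1) : expectation G X i ^ 2 ≤ expectation G (gramProd G X X) i := by
  classical
  set χ := expectation G X i with hχ
  set W := X * G - χ • (1 : Matrix n n 𝕜) with hW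
  have hdiag : 0 ≤ re ((Wᴴ * G * W) i i) :=
    (RCLike.nonneg_iff.1 (hG.conjTranspose_mul_mul_same W).diag_nonneg).1
  have hexpand : Wᴴ * G * W = G * gramProd G X X * G - (2 * χ) • (G * X * G) + χ ^ 2 • G := by
    simp only [hW, gramProd_self, conjTranspose_sub, conjTranspose_mul, conjTranspose_smul, hX.eq,
      hG.1.eq, conjTranspose_one, star_trivial, sub_mul, mul_sub, smul_mul_assoc, mul_smul_comm,
      Matrix.one_mul, Matrix.mul_one, Matrix.mul_assoc]
    module
  rw [hexpand, Matrix.add_apply, Matrix.sub_apply, Matrix.smul_apply, Matrix.smul_apply, hi]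
    at hdiag
  simp only [map_add, map_sub, smul_re, one_re, ← expectation_apply, ← hχ] at hdiag
  linarith

theorem sq_expectation_sub_le {X Y : Matrix n n 𝕜} (hG : G.PosSemidef) (hX : X.IsHermitian)
    (hY : Y.IsHermitian) {i : n} (hi : G i i = 1) (α β : ℝ) :
    (β * expectation G X i - α * expectation G Y i) ^ 2 ≤
      β ^ 2 * expectation G (gramProd G X X) i - 2 * α * β * expectation G (gramProd G X Y) i +
        α ^ 2 * expectation G (gramProd G Y Y) i := by
  have h := sq_expectation_le hG
    ((hX.smul (IsSelfAdjoint.all β)).sub (hY.smul (IsSelfAdjoint.all α))) hi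
  simp only [map_sub, map_smul, LinearMap.sub_apply, LinearMap.smul_apply, Pi.sub_apply,
    Pi.smul_apply, smul_eq_mul, gramProd_comm G Y X] at h
  linarith

theorem sum_mul_mul_le_of_symm {K : n → n → ℝ} (hK : ∀ i j, 0 ≤ K i j)
    (hsymm : ∀ i j, K i j = K j i) (a b : n → ℝ) :
    ∑ i, ∑ j, K i j * (a i * b i * (a j * b j)) ≤ ∑ i, ∑ j, K i j * (a i ^ 2 * b j ^ 2) := by
  have hswap : ∑ i, ∑ j, K i j * (a i ^ 2 * b j ^ 2) = ∑ i, ∑ j, K i j * (a j ^ 2 * b i ^ 2) := by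
    rw [Finset.sum_comm]
    simp only [hsymm]
  have hnonneg : 0 ≤ ∑ i, ∑ j, K i j * (a i * b j - a j * b i) ^ 2 :=
    Finset.sum_nonneg fun i _ => Finset.sum_nonneg fun j _ => mul_nonneg (hK i j) (sq_nonneg _)
  have hexpand : ∑ i, ∑ j, K i j * (a i * b j - a j * b i) ^ 2 =
      ∑ i, ∑ j, K i j * (a i ^ 2 * b j ^ 2) + ∑ i, ∑ j, K i j * (a j ^ 2 * b i ^ 2) -
        2 * ∑ i, ∑ j, K i j * (a i * b i * (a j * b j)) := by
    simp only [Finset.mul_sum, ← Finset.sum_add_distrib, ← Finset.sum_sub_distrib]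
    exact Finset.sum_congr rfl fun i _ => Finset.sum_congr rfl fun j _ => by ring
  linarith

variable (n 𝕜) in
/-- Coefficient matrices together with one odd coordinate for each vector `ξ i`. -/
abbrev AxialExt : Type _ := Matrix n n 𝕜 × (n → ℝ)

/-- The form on `AxialExt n 𝕜` that is the trace form on coefficient matrices and for which the odd
coordinates are orthonormal. -/
noncomputable def axialForm (G : Matrix n n 𝕜) : LinearMap.BilinForm ℝ (AxialExt n 𝕜) :=
  LinearMap.mk₂ ℝ (fun p q => gramForm G p.1 q.1 + p.2 ⬝ᵥ q.2)
    (fun p p' q => by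
      simp only [Prod.fst_add, Prod.snd_add, map_add, LinearMap.add_apply, add_dotProduct]; ring)
    (fun c p q => by
      simp only [Prod.smul_fst, Prod.smul_snd, map_smul, LinearMap.smul_apply, smul_dotProduct,
        smul_add])
    (fun p q q' => by
      simp only [Prod.fst_add, Prod.snd_add, map_add, dotProduct_add]; ring)
    (fun c p q => by
      simp only [Prod.smul_fst, Prod.smul_snd, map_smul, dotProduct_smul, smul_add])

theorem axialForm_apply (G : Matrix n n 𝕜) (p q : AxialExt n 𝕜) :
    axialForm G p q = gramForm G p.1 q.1 + p.2 ⬝ᵥ q.2 := rfl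

/-- The inclusion of the coefficient matrices in their axial extension. -/
noncomputable def ofMatrix : Matrix n n 𝕜 →ₗ[ℝ] AxialExt n 𝕜 := LinearMap.inl ℝ _ _

theorem axialForm_ofMatrix_ofMatrix (G X Y : Matrix n n 𝕜) :
    axialForm G (ofMatrix X) (ofMatrix Y) = gramTrace G (gramProd G X Y) := by
  simp [axialForm_apply, ofMatrix, gramForm_eq_gramTrace]

variable [DecidableEq n]

/-- The extension of the Jordan product to `AxialExt n 𝕜` for which the odd units `d i` satisfy
`d i * d i = |ξ i⟩⟨ξ i|`, `d i * d j = 0` for `i ≠ j` and `A * d i = ⟨ξ i, A (ξ i)⟩ d i`. -/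
noncomputable def axialMul (G : Matrix n n 𝕜) :
    AxialExt n 𝕜 →ₗ[ℝ] AxialExt n 𝕜 →ₗ[ℝ] AxialExt n 𝕜 :=
  LinearMap.mk₂ ℝ
    (fun p q => (gramProd G p.1 q.1 + realDiagonal (p.2 * q.2),
      expectation G p.1 * q.2 + expectation G q.1 * p.2))
    (fun p p' q => Prod.ext
      (by simp only [Prod.fst_add, Prod.snd_add, map_add, LinearMap.add_apply, add_mul]; abel)
      (by simp only [Prod.fst_add, Prod.snd_add, map_add, add_mul, mul_add]; abel))
    (fun c p q => Prod.ext
      (by simp only [Prod.smul_fst, Prod.smul_snd, map_smul, LinearMap.smul_apply, smul_mul_assoc,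
            smul_add])
      (by simp only [Prod.smul_fst, Prod.smul_snd, map_smul, smul_mul_assoc, mul_smul_comm,
            smul_add]))
    (fun p q q' => Prod.ext
      (by simp only [Prod.fst_add, Prod.snd_add, map_add, mul_add]; abel)
      (by simp only [Prod.fst_add, Prod.snd_add, map_add, add_mul, mul_add]; abel))
    (fun c p q => Prod.ext
      (by simp only [Prod.smul_fst, Prod.smul_snd, map_smul, mul_smul_comm, smul_add])
      (by simp only [Prod.smul_fst, Prod.smul_snd, map_smul, smul_mul_assoc, mul_smul_comm,
            smul_add]))

theorem axialMul_apply (G : Matrix n n 𝕜) (p q : AxialExt n 𝕜) :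
    axialMul G p q = (gramProd G p.1 q.1 + realDiagonal (p.2 * q.2),
      expectation G p.1 * q.2 + expectation G q.1 * p.2) := rfl

theorem axialMul_comm (G : Matrix n n 𝕜) (p q : AxialExt n 𝕜) :
    axialMul G p q = axialMul G q p := by
  rw [axialMul_apply, axialMul_apply, gramProd_comm, mul_comm p.2, add_comm (_ * q.2)]

theorem gramForm_realDiagonal_realDiagonal (hG : G.IsHermitian) (a b : n → ℝ) :
    gramForm G (realDiagonal a) (realDiagonal b) = ∑ i, ∑ j, normSq (G i j) * (a i * b j) := by
  rw [gramForm_comm]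
  simp only [gramForm_realDiagonal, dotProduct, expectation_realDiagonal hG, Finset.sum_mul]
  exact Finset.sum_congr rfl fun i _ => Finset.sum_congr rfl fun j _ => by ring

theorem axialForm_axialMul (hG : G.IsHermitian) (X Y X' Y' : Matrix n n 𝕜) (a b a' b' : n → ℝ) :
    axialForm G (axialMul G (X, a) (Y, b)) (axialMul G (X', a') (Y', b')) =
      gramForm G (gramProd G X Y) (gramProd G X' Y') +
      ∑ i, (expectation G (gramProd G X Y) i * (a' i * b' i) +
        expectation G (gramProd G X' Y') i * (a i * b i) +
        (expectation G X i * b i + expectation G Y i * a i) *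
          (expectation G X' i * b' i + expectation G Y' i * a' i)) +
      ∑ i, ∑ j, normSq (G i j) * (a i * b i * (a' j * b' j)) := by
  simp only [axialMul_apply, axialForm_apply, map_add, LinearMap.add_apply, gramForm_realDiagonal,
    gramForm_comm G (realDiagonal (a * b)) (gramProd G X' Y'),
    gramForm_realDiagonal_realDiagonal hG, dotProduct, Pi.mul_apply, Pi.add_apply,
    Finset.sum_add_distrib]
  ring

theorem axialForm_axialMul_le (hG : G.PosSemidef) (hdiag : ∀ i, G i i = 1)
    {p q : AxialExt n 𝕜} (hp : p.1.IsHermitian) (hq : q.1.IsHermitian) :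
    axialForm G (axialMul G p q) (axialMul G p q) ≤
      axialForm G (axialMul G p p) (axialMul G q q) := by
  obtain ⟨X, a⟩ := p
  obtain ⟨Y, b⟩ := q
  have hjordan := gramForm_gramProd_le hG hp hq
  have hcs := sum_mul_mul_le_of_symm (K := fun i j => normSq (G i j)) (fun i j => normSq_nonneg _)
    (fun i j => by rw [← hG.1.apply i j, star_def, normSq_conj]) a b
  rw [axialForm_axialMul hG.1, axialForm_axialMul hG.1]
  refine add_le_add (add_le_add hjordan (Finset.sum_le_sum fun i _ => ?_))
    (by simpa only [← sq] using hcs)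
  linarith [sq_expectation_sub_le hG hp hq (hdiag i) (a i) (b i)]

/-- The odd unit `d i` of the axial extension. -/
def oddUnit (i : n) : AxialExt n 𝕜 := (0, Pi.single i 1)

variable (G)

theorem axialMul_ofMatrix_ofMatrix (X Y : Matrix n n 𝕜) :
    axialMul G (ofMatrix X) (ofMatrix Y) = ofMatrix (gramProd G X Y) := by
  simp [axialMul_apply, ofMatrix]

theorem axialMul_ofMatrix_oddUnit (X : Matrix n n 𝕜) (i : n) :
    axialMul G (ofMatrix X) (oddUnit i) = expectation G X i • oddUnit i := by
  ext j
  · simp [axialMul_apply, ofMatrix, oddUnit]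
  · by_cases h : j = i <;> simp [axialMul_apply, ofMatrix, oddUnit, h]

theorem axialMul_oddUnit_ofMatrix (X : Matrix n n 𝕜) (i : n) :
    axialMul G (oddUnit i) (ofMatrix X) = expectation G X i • oddUnit i := by
  rw [axialMul_comm, axialMul_ofMatrix_oddUnit]

theorem axialMul_oddUnit_oddUnit (i j : n) :
    axialMul G (oddUnit i) (oddUnit j) = if i = j then ofMatrix (single i i 1) else 0 := by
  split_ifs with h
  · simp [axialMul_apply, ofMatrix, oddUnit, h, ← Pi.single_mul_left, realDiagonal_single]
  · simp [axialMul_apply, oddUnit, h, ← Pi.single_mul_left]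

theorem axialForm_ofMatrix_oddUnit (X : Matrix n n 𝕜) (i : n) :
    axialForm G (ofMatrix X) (oddUnit i) = 0 := by
  simp [axialForm_apply, ofMatrix, oddUnit]

theorem axialForm_oddUnit_ofMatrix (X : Matrix n n 𝕜) (i : n) :
    axialForm G (oddUnit i) (ofMatrix X) = 0 := by
  simp [axialForm_apply, ofMatrix, oddUnit]

theorem axialForm_oddUnit_oddUnit (i j : n) :
    axialForm G (oddUnit i) (oddUnit j) = if i = j then 1 else 0 := by
  simp [axialForm_apply, oddUnit, Pi.single_apply, eq_comm]

end AxialExtension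

/-! ### Operators attached to three equiangular lines -/

section ThreeLines

variable {ζ : ℂ} {t : ℝ}

theorem forall_fin_three {p : Fin 3 → Prop} : (∀ i, p i) ↔ p 0 ∧ p 1 ∧ p 2 := by
  simp [Fin.forall_fin_succ]

/-- The Gram matrix of three unit vectors `ξ i` of `ℂ³` whose inner products have absolute value
`1/4` and whose triple product has phase `ζ`. -/
noncomputable def lineGram (ζ : ℂ) : Matrix (Fin 3) (Fin 3) ℂ :=
  !![1, 1 / 4, star ζ / 4; 1 / 4, 1, 1 / 4; ζ / 4, 1 / 4, 1]

/-- The coefficient matrix of the projection `|ξ k⟩⟨ξ k|`, the image of `a_k + a_{-k}`. -/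
noncomputable def lineProj : Fin 3 → Matrix (Fin 3) (Fin 3) ℂ
  | 0 => !![1, 0, 0; 0, 0, 0; 0, 0, 0]
  | 1 => !![0, 0, 0; 0, 1, 0; 0, 0, 0]
  | 2 => !![0, 0, 0; 0, 0, 0; 0, 0, 1]

/-- The coefficient matrix of the projection that is the image of `v_k`. It has rank one, and its
range is spanned by a combination of the two vectors `ξ i` with `i ≠ k`. -/
noncomputable def pairProj (ζ : ℂ) : Fin 3 → Matrix (Fin 3) (Fin 3) ℂ
  | 0 => !![0, 0, 0; 0, 2 / 3, -2 / 3; 0, -2 / 3, 2 / 3]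
  | 1 => !![2 / 3, 0, -2 / 3 * star ζ; 0, 0, 0; -2 / 3 * ζ, 0, 2 / 3]
  | 2 => !![2 / 3, -2 / 3, 0; -2 / 3, 2 / 3, 0; 0, 0, 0]

/-- Half of the Jordan product of `lineProj k` and `pairProj ζ k`. It is the image of
`w_k - (t / 2) (a_k - a_{-k})`. -/
noncomputable def mixedOp (ζ : ℂ) : Fin 3 → Matrix (Fin 3) (Fin 3) ℂ
  | 0 => !![0, (1 - star ζ) / 24, (star ζ - 1) / 24; (1 - ζ) / 24, 0, 0; (ζ - 1) / 24, 0, 0]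
  | 1 => !![0, (1 - star ζ) / 24, 0; (1 - ζ) / 24, 0, (1 - star ζ) / 24; 0, (1 - ζ) / 24, 0]
  | 2 => !![0, 0, (star ζ - 1) / 24; 0, 0, (1 - star ζ) / 24; (ζ - 1) / 24, (1 - ζ) / 24, 0]

theorem isHermitian_lineProj (k : Fin 3) : (lineProj k).IsHermitian := by
  fin_cases k <;> simp [IsHermitian, ← Matrix.ext_iff, forall_fin_three, lineProj]

theorem isHermitian_pairProj (k : Fin 3) : (pairProj ζ k).IsHermitian := by
  fin_cases k <;>
    simp [IsHermitian, ← Matrix.ext_iff, forall_fin_three, pairProj, Complex.conj_ofNat]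

theorem isHermitian_mixedOp (k : Fin 3) : (mixedOp ζ k).IsHermitian := by
  fin_cases k <;>
    simp [IsHermitian, ← Matrix.ext_iff, forall_fin_three, mixedOp, Complex.conj_ofNat]

theorem third_eq : third 0 1 = 2 ∧ third 1 0 = 2 ∧ third 0 2 = 1 ∧ third 2 0 = 1 ∧ third 1 2 = 0 ∧
    third 2 1 = 0 := by
  decide

variable (hζ : ζ * star ζ = 1) (ht : (t : ℂ) = (2 - ζ - star ζ) / 24)

theorem gramProd_lineProj_lineProj (i j : Fin 3) :
    gramProd (lineGram ζ) (lineProj i) (lineProj j) =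
      if i = j then lineProj i
      else (8⁻¹ : ℝ) • (lineProj i + lineProj j) - (3 / 16 : ℝ) • pairProj ζ (third i j) := by
  revert i j
  simp only [gramProd_apply, forall_fin_three, third_eq, Fin.reduceEq, if_true, if_false,
    lineGram, lineProj, pairProj, mul_fin_three, ← Matrix.ext_iff, Matrix.smul_apply,
    Matrix.add_apply, Matrix.sub_apply, of_apply, cons_val, Complex.real_smul]
  push_cast
  and_intros <;> grind

include hζ in
theorem gramProd_lineProj_pairProj (i j : Fin 3) :
    gramProd (lineGram ζ) (lineProj i) (pairProj ζ j) =
      if i = j then (2 : ℝ) • mixedOp ζ i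
      else (4⁻¹ : ℝ) • (lineProj i - lineProj (third i j)) + (3 / 8 : ℝ) • pairProj ζ j := by
  revert i j
  simp only [gramProd_apply, forall_fin_three, third_eq, Fin.reduceEq, if_true, if_false,
    lineGram, lineProj, pairProj, mixedOp, mul_fin_three, ← Matrix.ext_iff, Matrix.smul_apply,
    Matrix.add_apply, Matrix.sub_apply, of_apply, cons_val, Complex.real_smul]
  push_cast
  and_intros <;> grind

include hζ ht in
theorem gramProd_lineProj_mixedOp (i j : Fin 3) :
    gramProd (lineGram ζ) (lineProj i) (mixedOp ζ j) =
      if i = j then (t / 4) • lineProj i + (2⁻¹ : ℝ) • mixedOp ζ i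
      else (t / 8) • lineProj i
        + (8⁻¹ : ℝ) • ((2 : ℝ) • mixedOp ζ j + mixedOp ζ i - (2 : ℝ) • mixedOp ζ (third j i)) := by
  revert i j
  simp only [gramProd_apply, forall_fin_three, third_eq, Fin.reduceEq, if_true, if_false,
    lineGram, lineProj, mixedOp, mul_fin_three, ← Matrix.ext_iff, Matrix.smul_apply,
    Matrix.add_apply, Matrix.sub_apply, of_apply, cons_val, Complex.real_smul]
  push_cast
  and_intros <;> grind

include hζ ht in
theorem gramProd_pairProj_pairProj (i j : Fin 3) :
    gramProd (lineGram ζ) (pairProj ζ i) (pairProj ζ j) =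
      if i = j then pairProj ζ i
      else -(4 * t / 3) • lineProj (third i j)
        + (4⁻¹ : ℝ) • (pairProj ζ i + pairProj ζ j - pairProj ζ (third i j))
        + (4 / 3 : ℝ) • ((2 : ℝ) • mixedOp ζ (third i j) - mixedOp ζ i - mixedOp ζ j) := by
  revert i j
  simp only [gramProd_apply, forall_fin_three, third_eq, Fin.reduceEq, if_true, if_false,
    lineGram, lineProj, pairProj, mixedOp, mul_fin_three, ← Matrix.ext_iff, Matrix.smul_apply,
    Matrix.add_apply, Matrix.sub_apply, of_apply, cons_val, Complex.real_smul]
  push_cast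
  and_intros <;> grind

include hζ ht in
theorem gramProd_pairProj_mixedOp (i j : Fin 3) :
    gramProd (lineGram ζ) (pairProj ζ i) (mixedOp ζ j) =
      if i = j then (t / 4) • pairProj ζ i + (2⁻¹ : ℝ) • mixedOp ζ i
      else -(t / 6) • lineProj j - (t / 3) • lineProj (third j i) + (t / 8) • pairProj ζ i
        + (4⁻¹ : ℝ) • (mixedOp ζ j + mixedOp ζ (third j i)) := by
  revert i j
  simp only [gramProd_apply, forall_fin_three, third_eq, Fin.reduceEq, if_true, if_false,
    lineGram, lineProj, pairProj, mixedOp, mul_fin_three, ← Matrix.ext_iff, Matrix.smul_apply,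
    Matrix.add_apply, Matrix.sub_apply, of_apply, cons_val, Complex.real_smul]
  push_cast
  and_intros <;> grind

include hζ ht in
theorem gramProd_mixedOp_mixedOp (i j : Fin 3) :
    gramProd (lineGram ζ) (mixedOp ζ i) (mixedOp ζ j) =
      if i = j then (t / 16) • (lineProj i + pairProj ζ i) + (t / 4) • mixedOp ζ i
      else -(t / 32) • lineProj (third i j)
        + (t / 64) • ((2 : ℝ) • pairProj ζ (third i j) + pairProj ζ i + pairProj ζ j)
        + (t / 8) • (mixedOp ζ i + mixedOp ζ j - mixedOp ζ (third i j)) := by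
  revert i j
  simp only [gramProd_apply, forall_fin_three, third_eq, Fin.reduceEq, if_true, if_false,
    lineGram, lineProj, pairProj, mixedOp, mul_fin_three, ← Matrix.ext_iff, Matrix.smul_apply,
    Matrix.add_apply, Matrix.sub_apply, of_apply, cons_val, Complex.real_smul]
  push_cast
  and_intros <;> grind

theorem single_one_eq_lineProj (i : Fin 3) : single i i 1 = lineProj i := by
  revert i
  simp [forall_fin_three, ← Matrix.ext_iff, lineProj]

theorem gramTrace_lineProj (k : Fin 3) : gramTrace (lineGram ζ) (lineProj k) = 1 := by
  revert k
  simp [gramTrace_apply, forall_fin_three, trace_fin_three, lineGram, lineProj]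

include hζ in
theorem gramTrace_pairProj (k : Fin 3) : gramTrace (lineGram ζ) (pairProj ζ k) = 1 := by
  have : trace (lineGram ζ * pairProj ζ k) = 1 := by
    revert k
    simp only [forall_fin_three, trace_fin_three, lineGram, pairProj, mul_fin_three, of_apply,
      cons_val]
    and_intros <;> grind
  rw [gramTrace_apply, this, one_re]

include hζ ht in
theorem gramTrace_mixedOp (k : Fin 3) : gramTrace (lineGram ζ) (mixedOp ζ k) = t / 2 := by
  have : trace (lineGram ζ * mixedOp ζ k) = (t / 2 : ℝ) := by
    revert k
    simp only [forall_fin_three, trace_fin_three, lineGram, mixedOp, mul_fin_three, of_apply,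
      cons_val]
    push_cast
    and_intros <;> grind
  rw [gramTrace_apply, this]
  exact Complex.ofReal_re _

include hζ in
theorem expectation_lineProj (i j : Fin 3) :
    expectation (lineGram ζ) (lineProj i) j = if j = i then 1 else 1 / 16 := by
  rw [expectation_eq_gramTrace, single_one_eq_lineProj, gramProd_lineProj_lineProj]
  split_ifs <;> simp only [map_sub, map_add, map_smul, smul_eq_mul, gramTrace_lineProj,
    gramTrace_pairProj hζ]
  norm_num

include hζ ht in
theorem expectation_pairProj (i j : Fin 3) :
    expectation (lineGram ζ) (pairProj ζ i) j = if j = i then t else 3 / 8 := by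
  rw [expectation_eq_gramTrace, single_one_eq_lineProj, gramProd_lineProj_pairProj hζ]
  split_ifs <;> simp only [map_sub, map_add, map_smul, smul_eq_mul, gramTrace_lineProj,
    gramTrace_pairProj hζ, gramTrace_mixedOp hζ ht] <;> ring

include hζ ht in
theorem expectation_mixedOp (i j : Fin 3) :
    expectation (lineGram ζ) (mixedOp ζ i) j = if j = i then t / 2 else 3 * t / 16 := by
  rw [expectation_eq_gramTrace, single_one_eq_lineProj, gramProd_lineProj_mixedOp hζ ht]
  split_ifs <;> simp only [map_sub, map_add, map_smul, smul_eq_mul, gramTrace_lineProj,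
    gramTrace_mixedOp hζ ht] <;> ring

/-! ### The realization of `M(t)` -/

/-- The basis of `M(t)` formed by the twelve vectors `e t p`. -/
noncomputable def stdBasis (t : ℝ) : Module.Basis Idx ℝ (M t) := Pi.basisFun ℝ Idx

theorem stdBasis_apply (t : ℝ) (p : Idx) : stdBasis t p = e t p := Pi.basisFun_apply ℝ Idx p

variable (ζ t) in
/-- The realization of `M(t)` in the axial extension. It sends `a_k + a_{-k}`, `v_k` and
`w_k - (t / 2) (a_k - a_{-k})` to operators, and `a_k - a_{-k}` to the odd unit `d k`. -/
noncomputable def realize : M t →ₗ[ℝ] AxialExt (Fin 3) ℂ :=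
  (stdBasis t).constr ℝ fun
    | .a i s =>
      (2⁻¹ : ℝ) • ofMatrix (lineProj i) + (if s = true then 2⁻¹ else -2⁻¹ : ℝ) • oddUnit i
    | .v k => ofMatrix (pairProj ζ k)
    | .w k => ofMatrix (mixedOp ζ k) + (t / 2) • oddUnit k

theorem realize_ax (i : Fin 3) (s : Bool) : realize ζ t (ax t i s) =
    (2⁻¹ : ℝ) • ofMatrix (lineProj i) + (if s = true then 2⁻¹ else -2⁻¹ : ℝ) • oddUnit i := by
  rw [ax, ← stdBasis_apply, realize, Module.Basis.constr_basis]

theorem realize_vv (k : Fin 3) : realize ζ t (vv t k) = ofMatrix (pairProj ζ k) := by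
  rw [vv, ← stdBasis_apply, realize, Module.Basis.constr_basis]

theorem realize_ww (k : Fin 3) :
    realize ζ t (ww t k) = ofMatrix (mixedOp ζ k) + (t / 2) • oddUnit k := by
  rw [ww, ← stdBasis_apply, realize, Module.Basis.constr_basis]

include hζ in
theorem realize_mulAA (i : Fin 3) (s : Bool) (j : Fin 3) (r : Bool) :
    realize ζ t (mulAA t i s j r) =
      axialMul (lineGram ζ) (realize ζ t (ax t i s)) (realize ζ t (ax t j r)) := by
  by_cases h : i = j <;> cases s <;> cases r <;>
  simp only [mulAA, realize_ax, realize_vv, map_add, map_sub, map_smul, map_zero,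
    LinearMap.add_apply, LinearMap.smul_apply, axialMul_ofMatrix_ofMatrix,
    axialMul_ofMatrix_oddUnit, axialMul_oddUnit_ofMatrix, axialMul_oddUnit_oddUnit,
    single_one_eq_lineProj, gramProd_lineProj_lineProj, expectation_lineProj hζ, if_true, if_false,
    h, @eq_comm _ j i, Bool.not_false, Bool.not_true, Bool.false_eq_true, Bool.true_eq_false] <;>
    module

section

include hζ ht

theorem realize_mulAV (i : Fin 3) (s : Bool) (k : Fin 3) :
    realize ζ t (mulAV t i s k) =
      axialMul (lineGram ζ) (realize ζ t (ax t i s)) (realize ζ t (vv t k)) := by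
  by_cases h : i = k <;> cases s <;>
  simp only [mulAV, realize_ax, realize_vv, realize_ww, map_add, map_sub, map_smul,
    LinearMap.add_apply, LinearMap.smul_apply, axialMul_ofMatrix_ofMatrix,
    axialMul_oddUnit_ofMatrix, gramProd_lineProj_pairProj hζ, expectation_pairProj hζ ht,
    if_true, if_false, h, Bool.not_false, Bool.not_true, Bool.false_eq_true] <;> module

theorem realize_mulAW (j : Fin 3) (s : Bool) (i : Fin 3) :
    realize ζ t (mulAW t j s i) =
      axialMul (lineGram ζ) (realize ζ t (ax t j s)) (realize ζ t (ww t i)) := by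
  by_cases h : j = i <;> cases s <;>
  simp only [mulAW, realize_ax, realize_ww, map_add, map_sub, map_smul,
    LinearMap.add_apply, LinearMap.smul_apply, axialMul_ofMatrix_ofMatrix,
    axialMul_ofMatrix_oddUnit, axialMul_oddUnit_ofMatrix, axialMul_oddUnit_oddUnit,
    single_one_eq_lineProj, gramProd_lineProj_mixedOp hζ ht, expectation_lineProj hζ,
    expectation_mixedOp hζ ht, if_true, if_false, h, @eq_comm _ i j, Bool.false_eq_true] <;> module

theorem realize_mulVV (j k : Fin 3) :
    realize ζ t (mulVV t j k) =
      axialMul (lineGram ζ) (realize ζ t (vv t j)) (realize ζ t (vv t k)) := by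
  simp only [mulVV, realize_vv, axialMul_ofMatrix_ofMatrix, gramProd_pairProj_pairProj hζ ht]
  split_ifs
  · rw [realize_vv]
  · simp only [realize_ax, realize_vv, realize_ww, map_add, map_sub, map_smul, if_true,
      if_false, Bool.false_eq_true]
    module

theorem realize_mulVW (k i : Fin 3) :
    realize ζ t (mulVW t k i) =
      axialMul (lineGram ζ) (realize ζ t (vv t k)) (realize ζ t (ww t i)) := by
  by_cases h : k = i <;>
  simp only [mulVW, realize_ax, realize_vv, realize_ww, map_add, map_sub, map_smul,
    axialMul_ofMatrix_ofMatrix, axialMul_ofMatrix_oddUnit, gramProd_pairProj_mixedOp hζ ht,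
    expectation_pairProj hζ ht, if_true, if_false, h, @eq_comm _ i k, Bool.false_eq_true] <;> module

theorem realize_mulWW (i j : Fin 3) :
    realize ζ t (mulWW t i j) =
      axialMul (lineGram ζ) (realize ζ t (ww t i)) (realize ζ t (ww t j)) := by
  by_cases h : i = j <;>
  simp only [mulWW, realize_ax, realize_vv, realize_ww, map_add, map_sub, map_smul,
    LinearMap.add_apply, LinearMap.smul_apply, axialMul_ofMatrix_ofMatrix,
    axialMul_ofMatrix_oddUnit, axialMul_oddUnit_ofMatrix, axialMul_oddUnit_oddUnit,
    single_one_eq_lineProj, gramProd_mixedOp_mixedOp hζ ht, expectation_mixedOp hζ ht, if_true,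
    if_false, h, @eq_comm _ j i, Bool.false_eq_true] <;> module

theorem realize_mulBasis (p q : Idx) :
    realize ζ t (mulBasis t p q) =
      axialMul (lineGram ζ) (realize ζ t (e t p)) (realize ζ t (e t q)) := by
  rcases p with ⟨i, s⟩ | i | i <;> rcases q with ⟨j, r⟩ | j | j
  · exact realize_mulAA hζ i s j r
  · exact realize_mulAV hζ ht i s j
  · exact realize_mulAW hζ ht i s j
  · rw [axialMul_comm]; exact realize_mulAV hζ ht j r i
  · exact realize_mulVV hζ ht i j
  · exact realize_mulVW hζ ht i j
  · rw [axialMul_comm]; exact realize_mulAW hζ ht j r i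
  · rw [axialMul_comm]; exact realize_mulVW hζ ht j i
  · exact realize_mulWW hζ ht i j

theorem realize_mul (x y : M t) :
    realize ζ t (x * y) = axialMul (lineGram ζ) (realize ζ t x) (realize ζ t y) := by
  have h : (LinearMap.mul ℝ (M t)).compr₂ (realize ζ t) =
      (axialMul (lineGram ζ)).compl₁₂ (realize ζ t) (realize ζ t) := by
    refine LinearMap.ext_basis (stdBasis t) (stdBasis t) fun p q => ?_
    simp only [LinearMap.compr₂_apply, LinearMap.compl₁₂_apply, LinearMap.mul_apply',
      stdBasis_apply, e_mul_e, realize_mulBasis hζ ht]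
  exact LinearMap.congr_fun₂ h x y

theorem gram_eq_axialForm (p q : Idx) :
    gram t p q = 2 * axialForm (lineGram ζ) (realize ζ t (e t p)) (realize ζ t (e t q)) := by
  have ha i s : e t (.a i s) = ax t i s := rfl
  have hv k : e t (.v k) = vv t k := rfl
  have hw k : e t (.w k) = ww t k := rfl
  cases p <;> cases q <;>
  simp only [gram, ha, hv, hw, realize_ax, realize_vv, realize_ww, map_add, map_sub, map_smul,
    LinearMap.add_apply, LinearMap.smul_apply, smul_eq_mul, axialForm_ofMatrix_ofMatrix,
    axialForm_ofMatrix_oddUnit, axialForm_oddUnit_ofMatrix, axialForm_oddUnit_oddUnit,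
    gramProd_comm _ (pairProj _ _) (lineProj _), gramProd_comm _ (mixedOp _ _) (lineProj _),
    gramProd_comm _ (mixedOp _ _) (pairProj _ _), gramProd_lineProj_lineProj,
    gramProd_lineProj_pairProj hζ, gramProd_lineProj_mixedOp hζ ht,
    gramProd_pairProj_pairProj hζ ht, gramProd_pairProj_mixedOp hζ ht,
    gramProd_mixedOp_mixedOp hζ ht, apply_ite (gramTrace _), gramTrace_lineProj,
    gramTrace_pairProj hζ, gramTrace_mixedOp hζ ht] <;>
  grind

theorem form_eq_axialForm (x y : M t) :
    form t x y = 2 * axialForm (lineGram ζ) (realize ζ t x) (realize ζ t y) := by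
  have h : form t = (2 : ℝ) • (axialForm (lineGram ζ)).compl₁₂ (realize ζ t) (realize ζ t) := by
    refine LinearMap.ext_basis (stdBasis t) (stdBasis t) fun p q => ?_
    rw [stdBasis_apply, stdBasis_apply, form_e_e, gram_eq_axialForm hζ ht]
    rfl
  rw [h]
  rfl

end

theorem isHermitian_realize (x : M t) : (realize ζ t x).1.IsHermitian := by
  rw [realize, Module.Basis.constr_apply_fintype, Prod.fst_sum]
  refine isSelfAdjoint_sum _ fun p _ => IsSelfAdjoint.smul (.all _) ?_
  rcases p with ⟨i, s⟩ | k | k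
  · have := IsSelfAdjoint.smul (.all (2⁻¹ : ℝ)) (isHermitian_lineProj i).isSelfAdjoint
    simpa only [ofMatrix, oddUnit, LinearMap.inl_apply, Prod.fst_add, Prod.smul_fst, smul_zero,
      add_zero] using this
  · exact isHermitian_pairProj k
  · simpa only [ofMatrix, oddUnit, LinearMap.inl_apply, Prod.fst_add, Prod.smul_fst, smul_zero,
      add_zero] using (isHermitian_mixedOp k).isSelfAdjoint

include hζ in
theorem posSemidef_lineGram : (lineGram ζ).PosSemidef := by
  -- each row of the second factor accounts for one pair of off-diagonal entries of `lineGram ζ`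
  have h : lineGram ζ = (2⁻¹ : ℝ) • 1 +
      (4⁻¹ : ℝ) • ((!![1, 1, 0; 0, 1, 1; ζ, 0, 1])ᴴ * !![1, 1, 0; 0, 1, 1; ζ, 0, 1]) := by
    simp only [lineGram, one_fin_three, ← Matrix.ext_iff, forall_fin_three, Matrix.add_apply,
      Matrix.smul_apply, Matrix.mul_apply, Fin.sum_univ_three, conjTranspose_apply, of_apply,
      cons_val, star_one, star_zero, Complex.real_smul]
    push_cast
    and_intros <;> grind
  rw [h]
  exact (PosSemidef.one.smul (by norm_num)).add
    ((posSemidef_conjTranspose_mul_self _).smul (by norm_num))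

theorem lineGram_apply_self (i : Fin 3) : lineGram ζ i i = 1 := by
  fin_cases i <;> rfl

theorem exists_phase_of_mem_Icc (h : t ∈ Set.Icc (0 : ℝ) (1 / 6)) :
    ∃ ζ : ℂ, ζ * star ζ = 1 ∧ (t : ℂ) = (2 - ζ - star ζ) / 24 := by
  have hs : 0 ≤ 1 - (1 - 12 * t) ^ 2 := by nlinarith [h.1, h.2]
  refine ⟨⟨1 - 12 * t, √(1 - (1 - 12 * t) ^ 2)⟩, ?_, ?_⟩
  · rw [Complex.star_def, Complex.mul_conj, Complex.normSq_mk, Real.mul_self_sqrt hs]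
    norm_num [← sq]
  · rw [Complex.star_def, sub_sub, Complex.add_conj]
    push_cast
    ring

theorem nortonInequality_of_mem_Icc (h : t ∈ Set.Icc (0 : ℝ) (1 / 6)) :
    NortonInequality (form t) := by
  obtain ⟨ζ, hζ, ht⟩ := exists_phase_of_mem_Icc h
  intro u v
  simp only [form_eq_axialForm hζ ht, realize_mul hζ ht]
  linarith [axialForm_axialMul_le (posSemidef_lineGram hζ) lineGram_apply_self
    (isHermitian_realize (ζ := ζ) u) (isHermitian_realize (ζ := ζ) v)]

end ThreeLines

/-! ### The two test pairs -/

section TestPairs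

variable {t : ℝ}

/-- The difference `a_i - a_{-i}`, on which the sign change `a_i ↔ a_{-i}` acts as `-1`. -/
noncomputable def oddAxis (t : ℝ) (i : Fin 3) : M t := ax t i true - ax t i false

theorem oddAxis_mul_self (t : ℝ) (i : Fin 3) :
    oddAxis t i * oddAxis t i = ax t i true + ax t i false := by
  simp only [oddAxis, mul_sub, sub_mul, ax, e_mul_e, mulBasis, mulAA, if_true, if_false,
    Bool.false_eq_true, Bool.true_eq_false]
  abel

theorem vv_mul_oddAxis (t : ℝ) (i : Fin 3) : vv t i * oddAxis t i = t • oddAxis t i := by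
  simp only [oddAxis, mul_sub, ax, vv, e_mul_e, mulBasis, mulAV, if_true, if_false,
    Bool.false_eq_true]
  abel

theorem mem_Icc_zero_one_of_nortonInequality (h : NortonInequality (form t)) :
    t ∈ Set.Icc (0 : ℝ) 1 := by
  have hvv : vv t 0 * vv t 0 = vv t 0 := e_mul_e t _ _
  have hright : form t (oddAxis t 0) (oddAxis t 0) = 2 := by
    simp only [oddAxis, ax, map_sub, LinearMap.sub_apply, form_e_e, gram, if_true, if_false,
      Bool.false_eq_true, Bool.true_eq_false]
    norm_num
  have hleft : form t (vv t 0) (ax t 0 true + ax t 0 false) = 2 * t := by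
    simp only [ax, vv, map_add, form_e_e, gram, if_true]
    ring
  have key : t * (t * 2) ≤ 2 * t := by
    simpa only [oddAxis_mul_self, vv_mul_oddAxis, hvv, hleft, map_smul, LinearMap.smul_apply,
      hright, smul_eq_mul] using h (vv t 0) (oddAxis t 0)
  constructor <;> nlinarith

/-- The component of `w_k` that is realized by an operator, namely by `mixedOp`. -/
noncomputable def evenW (t : ℝ) (k : Fin 3) : M t := ww t k - (t / 2) • oddAxis t k

/-- The vector that violates Norton's inequality, together with `a_1 - a_{-1}`, for `1/6 < t ≤ 1`.
Both differences have product zero with `a_1 - a_{-1}`, and `-20` minimizes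
`⟨u · u, a_1 + a_{-1}⟩` for the given first coefficient. -/
noncomputable def testVector (t : ℝ) : M t :=
  (3 + 2 * t) • (vv t 1 - vv t 2) - (20 : ℝ) • (evenW t 1 - evenW t 2)

theorem testVector_mul_oddAxis (t : ℝ) : testVector t * oddAxis t 0 = 0 := by
  simp only [testVector, evenW, oddAxis, mul_sub, sub_mul, smul_mul_assoc, ax, vv, ww, e_mul_e,
    mulBasis, mulAA, mulAV, mulAW, third_eq, Fin.reduceEq, if_true, if_false, Bool.not_true,
    Bool.not_false, Bool.false_eq_true]
  module

theorem form_testVector_sq (t : ℝ) :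
    form t (testVector t * testVector t) (ax t 0 true + ax t 0 false) =
      (3 + 2 * t) * (9 - 4 * t) * (1 - 6 * t) / 4 := by
  simp only [testVector, evenW, oddAxis, mul_sub, sub_mul, smul_mul_assoc, mul_smul_comm, ax, vv,
    ww, e_mul_e, mulBasis, mulAA, mulAV, mulAW, mulVV, mulVW, mulWW, third_eq, Fin.reduceEq,
    if_true, if_false, Bool.not_true, Bool.not_false, Bool.false_eq_true, Bool.true_eq_false,
    map_add, map_sub, map_smul, map_zero, LinearMap.add_apply, LinearMap.sub_apply,
    LinearMap.smul_apply, LinearMap.zero_apply, form_e_e, gram, smul_eq_mul]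
  ring

theorem le_one_sixth_of_nortonInequality (h : NortonInequality (form t)) : t ≤ 1 / 6 := by
  obtain ⟨ht₀, ht₁⟩ := mem_Icc_zero_one_of_nortonInequality h
  have key := h (testVector t) (oddAxis t 0)
  rw [testVector_mul_oddAxis, oddAxis_mul_self, form_testVector_sq, map_zero] at key
  have hpos : 0 < (3 + 2 * t) * (9 - 4 * t) := mul_pos (by linarith) (by linarith)
  have : 0 ≤ 1 - 6 * t := nonneg_of_mul_nonneg_right (by linarith : 0 ≤ _ * (1 - 6 * t)) hpos
  linarith

end TestPairs

end FourA

theorem proposition6p6 (t : ℝ) :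
    FourA.NortonInequality (FourA.form t) ↔ t ∈ Set.Icc (0 : ℝ) (1 / 6) :=
  ⟨fun h => ⟨(FourA.mem_Icc_zero_one_of_nortonInequality h).1,
    FourA.le_one_sixth_of_nortonInequality h⟩, FourA.nortonInequality_of_mem_Icc⟩
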